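/- Let $\mathcal A$ be an abelian length category, i.e. an abelian category in which every object has a composition series. All subcategories are full, closed under isomorphisms, and contain the zero object. Let $\operatorname{wide}\mathcal A$ be the set of wide subcategories of $\mathcal A$ (closed under extensions, kernels and cokernels) and $\operatorname{tors}\mathcal A$ the set of torsion classes (closed under extensions and quotients), both ordered by inclusion, and for a subcategory $\mathcal C$ let $T(\mathcal C)$ be the smallest torsion class containing $\mathcal C$. A complete lattice $L$ is completely semidistributive if for all $a,b\in L$ and all non-empty $X\subseteq L$: if $a\vee x=b$ for all $x\in X$ then $a\vee\bigwedge X=b$, and if $a\wedge x=b$ for all $x\in X$ then $a\wedge\bigvee X=b$. In such an $L$, for a completely join-irreducible $j$ (that is, $j=\bigvee X$ implies $j\in X$) put $j_*=\bigvee\{x\in L\mid x<j\}$ and $\kappa(j)=\max\{x\in L\mid j\wedge x=j_*\}$. An expression $x=\bigvee S$ is a canonical join representation of $x\in L$ if $S\subseteq L$ is an antichain and, whenever $x=\bigvee B$ with $B\subseteq L$, every $a\in S$ satisfies $a\le b$ for some $b\in B$; such an $S$ is unique if it exists, and it consists of completely join-irreducible elements. Let $L_0$ be the set of elements with a canonical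 join representation; for $x\in L_0$ with canonical join representation $x=\bigvee S$ put $\bar\kappa(x)=\bigwedge\{\kappa(j)\mid j\in S\}$. Let $L_\kappa$ be the set $L_0$ with the partial order $$x\le_\kappa y\iff x\le y\text{ and }\bar\kappa(x)\ge\bar\kappa(y)\text{ in }L.$$ Then $\operatorname{tors}\mathcal A$ is a completely semidistributive lattice, and the map $\mathcal W\mapsto T(\mathcal W)$ is an isomorphism of posets from $\operatorname{wide}\mathcal A$ onto $(\operatorname{tors}\mathcal A)_\kappa$. -/

import Mathlib

open CategoryTheory CategoryTheory.Limits

universe v u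

noncomputable section

namespace KappaOrder

section Lattice

variable {L : Type u} [CompleteLattice L]

/-- `j` is completely join-irreducible: `j = ⋁ X` implies `j ∈ X`.
(With `X = ∅` this excludes the least element.) -/
def IsCompletelyJoinIrreducible (j : L) : Prop :=
  ∀ X : Set L, j = sSup X → j ∈ X

/-- `a_*`, the join of all elements strictly below `a`. -/
def lowerStar (a : L) : L := sSup {x | x < a}

variable (L) in
/-- Complete semidistributivity of a complete lattice. -/
structure IsCompletelySemidistributive : Prop where
  sup_sInf : ∀ (a b : L) (X : Set L), X.Nonempty → (∀ x ∈ X, a ⊔ x = b) → a ⊔ sInf X = b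
  inf_sSup : ∀ (a b : L) (X : Set L), X.Nonempty → (∀ x ∈ X, a ⊓ x = b) → a ⊓ sSup X = b

/-- The kappa map. On a completely join-irreducible element `j` of a completely semidistributive
lattice this is `max {x | j ⊓ x = j_*}`, see `isGreatest_kappa`. -/
def kappa (j : L) : L := sSup {x | j ⊓ x = lowerStar j}

theorem isGreatest_kappa (hL : IsCompletelySemidistributive L) (j : L) :
    IsGreatest {x | j ⊓ x = lowerStar j} (kappa j) := by
  have hmem : lowerStar j ∈ {x | j ⊓ x = lowerStar j} :=
    inf_eq_right.2 (sSup_le fun x hx => le_of_lt hx)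
  exact ⟨hL.inf_sSup j _ _ ⟨_, hmem⟩ fun x hx => hx, fun x hx => le_sSup hx⟩

/-- `x = ⋁ S` is a canonical join representation of `x`. -/
structure IsCanonicalJoinRep (x : L) (S : Set L) : Prop where
  eq_sSup : x = sSup S
  refines : ∀ B : Set L, x = sSup B → ∀ a ∈ S, ∃ b ∈ B, a ≤ b
  antichain : ∀ a ∈ S, ∀ b ∈ S, a ≤ b → a = b

theorem IsCanonicalJoinRep.unique {x : L} {S S' : Set L}
    (h : IsCanonicalJoinRep x S) (h' : IsCanonicalJoinRep x S') : S = S' := by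
  have key : ∀ {S S' : Set L}, IsCanonicalJoinRep x S → IsCanonicalJoinRep x S' → S ⊆ S' := by
    intro S S' h h' a ha
    obtain ⟨b, hb, hab⟩ := h.refines S' h'.eq_sSup a ha
    obtain ⟨c, hc, hbc⟩ := h'.refines S h.eq_sSup b hb
    have hac := h.antichain a ha c hc (hab.trans hbc)
    have : a = b := le_antisymm hab (hac ▸ hbc)
    exact this ▸ hb
  exact Set.Subset.antisymm (key h h') (key h' h)

theorem IsCanonicalJoinRep.isCompletelyJoinIrreducible {x : L} {S : Set L}
    (h : IsCanonicalJoinRep x S) {a : L} (ha : a ∈ S) : IsCompletelyJoinIrreducible a := by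
  intro X hX
  have hx : x = sSup (X ∪ (S \ {a})) := by
    rw [sSup_union, ← hX, ← sSup_insert, Set.insert_sdiff_singleton, Set.insert_eq_of_mem ha]
    exact h.eq_sSup
  obtain ⟨b, hb | hb, hab⟩ := h.refines _ hx a ha
  · have : a = b := le_antisymm hab (hX ▸ le_sSup hb)
    exact this ▸ hb
  · exact absurd (h.antichain a ha b hb.1 hab).symm hb.2

variable (L) in
/-- The elements of `L` which have a canonical join representation, to be ordered by the
kappa order (this is a structure, so it does not inherit the order of `L`). -/
@[ext]
structure KappaPoset where
  val : L
  hasCJR : ∃ S : Set L, IsCanonicalJoinRep val S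

namespace KappaPoset

/-- The canonical join representation of `x`. -/
def CJR (x : KappaPoset L) : Set L := x.hasCJR.choose

theorem isCanonicalJoinRep_CJR (x : KappaPoset L) : IsCanonicalJoinRep x.val x.CJR :=
  x.hasCJR.choose_spec

/-- The extended kappa map. -/
def extKappa (x : KappaPoset L) : L := sInf (kappa '' x.CJR)

/-- The kappa order: `x ≤ y` and `extKappa x ≥ extKappa y` in `L`. -/
instance : PartialOrder (KappaPoset L) where
  le x y := x.val ≤ y.val ∧ extKappa x ≥ extKappa y
  le_refl x := ⟨le_rfl, le_rfl⟩
  le_trans x y z h h' := ⟨h.1.trans h'.1, h'.2.trans h.2⟩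
  le_antisymm x y h h' := KappaPoset.ext (le_antisymm h.1 h'.1)

end KappaPoset

end Lattice

section Category

variable {A : Type u} [Category.{v} A] [Abelian A]

/-- `X` has a composition series: a finite chain `0 = F 0 ≤ F 1 ≤ ⋯ ≤ F n = X` of subobjects
with simple subquotients (the values of `F` beyond `n` are then all equal to `X`). -/
def HasCompositionSeries (X : A) : Prop :=
  ∃ (n : ℕ) (F : ℕ → Subobject X) (hF : Monotone F), F 0 = ⊥ ∧ F n = ⊤ ∧
    ∀ i < n, Simple (cokernel (Subobject.ofLE (F i) (F (i + 1)) (hF (Nat.le_succ i))))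

variable (A) in
/-- An abelian length category: every object has a composition series. -/
class IsLengthCategory : Prop where
  hasCompositionSeries : ∀ X : A, HasCompositionSeries X

/-- A full subcategory, given by its objects, is a torsion class: it contains zero and is closed
under quotients and extensions. Closure under isomorphisms follows from that under quotients. -/
structure IsTorsionClass (P : ObjectProperty A) : Prop where
  containsZero : P.ContainsZero
  quotients : P.IsClosedUnderQuotients
  extensions : P.IsClosedUnderExtensions

/-- A full subcategory, given by its objects, is wide: it is closed under isomorphisms,
contains zero, and is closed under extensions, kernels and cokernels. -/
structure IsWideSubcategory (P : ObjectProperty A) : Prop where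
  isos : P.IsClosedUnderIsomorphisms
  containsZero : P.ContainsZero
  extensions : P.IsClosedUnderExtensions
  kernels : P.IsClosedUnderKernels
  cokernels : P.IsClosedUnderCokernels

variable (A) in
/-- The poset of wide subcategories, ordered by inclusion. -/
abbrev WideSubcategory : Type u := {P : ObjectProperty A // IsWideSubcategory P}

variable (A) in
/-- The torsion classes, ordered by inclusion. -/
abbrev TorsionClass : Type u := {P : ObjectProperty A // IsTorsionClass P}

namespace TorsionClass

/-- The intersection of a set of torsion classes. -/
instance : InfSet (TorsionClass A) where
  sInf s := ⟨fun X => ∀ T ∈ s, T.1 X,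
    { containsZero := ⟨⟨_, isZero_zero A, fun T _ => by
        have := T.2.containsZero
        have := T.2.quotients
        exact T.1.prop_zero⟩⟩
      quotients := ⟨fun f _ hX T hT => T.2.quotients.prop_of_epi f (hX T hT)⟩
      extensions := ⟨fun hS h₁ h₃ T hT =>
        T.2.extensions.prop_X₂_of_shortExact hS (h₁ T hT) (h₃ T hT)⟩ }⟩

/-- The complete lattice of torsion classes; meets are intersections. -/
instance : CompleteLattice (TorsionClass A) :=
  completeLatticeOfInf (TorsionClass A) fun _ =>
    ⟨fun T hT _ hX => hX T hT, fun _ hU X hX T hT => hU hT X hX⟩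

end TorsionClass

/-- `T(C)`, the smallest torsion class containing `C`. -/
def torsionClosure (P : ObjectProperty A) : TorsionClass A :=
  sInf {T : TorsionClass A | P ≤ T.1}

end Category

end KappaOrder

end

noncomputable section

namespace KappaOrder

variable {A : Type u} [Category.{v} A] [Abelian A]

/-! ### Short exact sequences -/

/-! Two facts about torsion classes give complete semidistributivity. The objects without nonzero
morphisms to `M` form a torsion class, so a nonzero object of a join receives a nonzero morphism
from some joinand, and an object is torsion-free for a join as soon as it is so for each joinand.
Finite length supplies minimal counterexamples: among quotients for the meet law, among subobjects
of torsion-free objects for the join law.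

For wide `W`, the simple objects of `W` are Hom-orthogonal bricks `B` that filter every object of
`W`. A nonzero morphism from T(W) to such a `B` is epi, so the classes T(B) form the canonical join
representation of T(W) (`isCanonicalJoinRep`). As κ(T(B)) is the left perpendicular class of `B`,
the extended kappa of T(W) is ⊥W, the objects without nonzero morphisms to `W`. Finally `W` consists
of the objects of T(W) that receive no nonzero morphism from ⊥W (`prop_of_torsionClosure`), so the
pair (T(W), ⊥W), hence the kappa order, determines inclusion of wide subcategories.

For surjectivity, completely join-irreducible torsion classes have the form T(B) with `B` a brick.
If T(B) is a canonical joinand of `T`, then `B` lies in the wide subcategory `wideCore T`, which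
therefore generates `T`. -/

theorem shortExact_of_mono {X Y : A} (i : X ⟶ Y) [Mono i] :
    (ShortComplex.mk i (cokernel.π i) (cokernel.condition i)).ShortExact :=
  { exact := ShortComplex.exact_cokernel i }

theorem shortExact_of_epi {X Y : A} (p : X ⟶ Y) [Epi p] :
    (ShortComplex.mk (kernel.ι p) p (kernel.condition p)).ShortExact :=
  { exact := ShortComplex.exact_kernel p }

theorem prop_of_mono_of_cokernel {P : ObjectProperty A} (hP : P.IsClosedUnderExtensions)
    {X Y : A} (i : X ⟶ Y) [Mono i] (hX : P X) (hC : P (cokernel i)) : P Y :=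
  hP.prop_X₂_of_shortExact (shortExact_of_mono i) hX hC

theorem prop_of_epi_of_kernel {P : ObjectProperty A} (hP : P.IsClosedUnderExtensions)
    {X Y : A} (p : X ⟶ Y) [Epi p] (hK : P (kernel p)) (hY : P Y) : P X :=
  hP.prop_X₂_of_shortExact (shortExact_of_epi p) hK hY

theorem exists_lift {S : ShortComplex A} (hS : S.ShortExact) {Y : A} (f : Y ⟶ S.X₂)
    (hf : f ≫ S.g = 0) : ∃ f' : Y ⟶ S.X₁, f' ≫ S.f = f :=
  have := hS.mono_f
  ⟨hS.exact.lift f hf, hS.exact.lift_f f hf⟩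

theorem exists_desc {S : ShortComplex A} (hS : S.ShortExact) {Y : A} (f : S.X₂ ⟶ Y)
    (hf : S.f ≫ f = 0) : ∃ f' : S.X₃ ⟶ Y, S.g ≫ f' = f :=
  have := hS.epi_g
  ⟨hS.exact.desc f hf, hS.exact.g_desc f hf⟩

theorem not_mono_of_epi_of_not_isIso {X Y : A} {f : X ⟶ Y} [Epi f] (hf : ¬ IsIso f) : ¬ Mono f :=
  fun _ => hf (isIso_of_mono_of_epi f)

theorem not_epi_of_mono_of_not_isIso {X Y : A} {f : X ⟶ Y} [Mono f] (hf : ¬ IsIso f) : ¬ Epi f :=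
  fun _ => hf (isIso_of_mono_of_epi f)

theorem image_ι_eq_zero_iff {X Y : A} (f : X ⟶ Y) : Abelian.image.ι f = 0 ↔ f = 0 := by
  constructor
  · intro h
    rw [← Abelian.image.fac f, h, comp_zero]
  · intro h
    rw [← cancel_epi (Abelian.factorThruImage f), Abelian.image.fac, h, comp_zero]

theorem epi_of_isIso_image_ι {X Y : A} (f : X ⟶ Y) [IsIso (Abelian.image.ι f)] : Epi f := by
  rw [← Abelian.image.fac f]
  infer_instance

theorem not_isIso_cokernel_π {X Y : A} {f : X ⟶ Y} (hf : f ≠ 0) : ¬ IsIso (cokernel.π f) :=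
  fun _ => hf (by rw [← cancel_mono (cokernel.π f), cokernel.condition, zero_comp])

theorem not_isIso_kernel_ι {X Y : A} {f : X ⟶ Y} (hf : f ≠ 0) : ¬ IsIso (kernel.ι f) :=
  fun _ => hf (by rw [← cancel_epi (kernel.ι f), kernel.condition, comp_zero])

/-! ### Length of objects -/

/-- `X` is an iterated extension of `n` simple objects. -/
def HasLength : ℕ → A → Prop
  | 0, X => IsZero X
  | n + 1, X => ∃ S : ShortComplex A, S.ShortExact ∧ S.X₂ = X ∧ HasLength n S.X₁ ∧ Simple S.X₃

/-- Map `Y` to the top simple quotient of `X`: either `Y` lies in the kernel, or it surjects and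
only its intersection with the kernel has to be measured. The strict drop for proper subobjects is
all that the inductions need; uniqueness of length is never used. -/
theorem HasLength.of_mono {n : ℕ} : ∀ {X Y : A} (i : Y ⟶ X) [Mono i], HasLength n X →
    ∃ m ≤ n, HasLength m Y ∧ (¬ IsIso i → m < n) := by
  induction n with
  | zero =>
    intro X Y i _ hX
    have hX : IsZero X := hX
    have hY : IsZero Y := IsZero.of_mono i hX
    exact ⟨0, le_rfl, hY, fun h => (h ⟨0, hY.eq_of_src _ _, hX.eq_of_src _ _⟩).elim⟩
  | succ n ih =>
    rintro X Y i _ ⟨S, hS, rfl, hK, hQ⟩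
    have := hS.mono_f
    by_cases h : i ≫ S.g = 0
    · obtain ⟨l, hl⟩ := exists_lift hS i h
      have : Mono l := by
        have : Mono (l ≫ S.f) := hl ▸ inferInstance
        exact mono_of_mono l S.f
      obtain ⟨m, hm, hY, -⟩ := ih l hK
      exact ⟨m, by omega, hY, fun _ => by omega⟩
    · have : Epi (i ≫ S.g) := epi_of_nonzero_to_simple h
      obtain ⟨l, hl⟩ := exists_lift hS (kernel.ι (i ≫ S.g) ≫ i)
        (by rw [Category.assoc, kernel.condition])
      have : Mono l := by
        have : Mono (l ≫ S.f) := hl ▸ inferInstance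
        exact mono_of_mono l S.f
      obtain ⟨m, hm, hY, hlt⟩ := ih l hK
      refine ⟨m + 1, by omega, ⟨_, shortExact_of_epi (i ≫ S.g), rfl, hY, hQ⟩, fun hi => ?_⟩
      suffices ¬ IsIso l by have := hlt this; omega
      intro _
      -- If `l` is invertible, then `Y` contains `S.X₁` and surjects onto `S.X₃`, so `i` is epi.
      refine not_epi_of_mono_of_not_isIso hi (Preadditive.epi_of_cancel_zero _ fun {Z} t ht => ?_)
      have h0 : S.f ≫ t = 0 := by
        rw [← cancel_epi l, reassoc_of% hl, ht, comp_zero, comp_zero]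
      obtain ⟨t', rfl⟩ := exists_desc hS t h0
      have : t' = 0 := by
        rw [← cancel_epi (i ≫ S.g), Category.assoc, ht, comp_zero]
      rw [this, comp_zero]

/-- The image of `S.X₁` in `Z` has as cokernel a quotient of the simple object `S.X₃`, hence zero or
simple. -/
theorem HasLength.of_epi {n : ℕ} : ∀ {X Z : A} (e : X ⟶ Z) [Epi e], HasLength n X →
    ∃ m ≤ n, HasLength m Z ∧ (¬ IsIso e → m < n) := by
  induction n with
  | zero =>
    intro X Z e _ hX
    have hX : IsZero X := hX
    have hZ : IsZero Z := IsZero.of_epi e hX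
    exact ⟨0, le_rfl, hZ, fun h => (h ⟨0, hX.eq_of_src _ _, hZ.eq_of_src _ _⟩).elim⟩
  | succ n ih =>
    rintro X Z e _ ⟨S, hS, rfl, hK, hQ⟩
    have := hS.mono_f
    have := hS.epi_g
    obtain ⟨d, hd⟩ := exists_desc hS (e ≫ cokernel.π (S.f ≫ e))
      (by rw [← Category.assoc, cokernel.condition])
    have : Epi d := by
      have : Epi (S.g ≫ d) := hd ▸ inferInstance
      exact epi_of_epi S.g d
    by_cases h : d = 0
    · have h0 : cokernel.π (S.f ≫ e) = 0 := by
        rw [← cancel_epi e, ← hd, h, comp_zero, comp_zero]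
      have : Epi (S.f ≫ e) := Preadditive.epi_of_cokernel_zero h0
      obtain ⟨m, hm, hZ, -⟩ := ih (S.f ≫ e) hK
      exact ⟨m, by omega, hZ, fun _ => by omega⟩
    · have : IsIso d := isIso_of_epi_of_nonzero h
      obtain ⟨m, hm, hY, hlt⟩ := ih (Abelian.factorThruImage (S.f ≫ e)) hK
      have hsimple : Simple (cokernel (S.f ≫ e)) := Simple.of_iso (asIso d).symm
      refine ⟨m + 1, by omega, ⟨_, shortExact_of_epi (cokernel.π (S.f ≫ e)), rfl, hY, hsimple⟩,
        fun he => ?_⟩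
      suffices ¬ IsIso (Abelian.factorThruImage (S.f ≫ e)) by have := hlt this; omega
      intro _
      have hmono : Mono (S.f ≫ e) := by
        rw [← Abelian.image.fac (S.f ≫ e)]
        infer_instance
      refine not_mono_of_epi_of_not_isIso he (Preadditive.mono_of_cancel_zero _ fun {Y} t ht => ?_)
      have h0 : t ≫ S.g = 0 := by
        rw [← cancel_mono d, Category.assoc, hd, reassoc_of% ht, zero_comp, zero_comp]
      obtain ⟨s, rfl⟩ := exists_lift hS t h0
      have : s = 0 := by
        rw [← cancel_mono (S.f ≫ e), ← Category.assoc, ht, zero_comp]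
      rw [this, zero_comp]

theorem HasCompositionSeries.exists_hasLength {X : A} (h : HasCompositionSeries X) :
    ∃ n, HasLength n X := by
  obtain ⟨n, F, hF, h0, hn, hs⟩ := h
  have key : ∀ k ≤ n, HasLength k (F k : A) := by
    intro k
    induction k with
    | zero =>
      intro _
      rw [h0]
      exact (isZero_zero A).of_iso Subobject.botCoeIsoZero
    | succ k ih =>
      intro hk
      exact ⟨_, shortExact_of_mono (Subobject.ofLE (F k) (F (k + 1)) (hF (Nat.le_succ k))), rfl,
        ih (by omega), hs k (by omega)⟩
  have hX := key n le_rfl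
  rw [hn] at hX
  -- Length is transported along the isomorphism by regarding it as a mono.
  obtain ⟨m, -, hm, -⟩ := hX.of_mono (inv (⊤ : Subobject X).arrow)
  exact ⟨m, hm⟩

section Induction

variable [IsLengthCategory A]

/-- Induction over proper subobjects. -/
theorem subobject_induction {P : A → Prop}
    (h : ∀ X : A, (∀ (Y : A) (i : Y ⟶ X) [Mono i], ¬ IsIso i → P Y) → P X) (X : A) : P X := by
  obtain ⟨n, hn⟩ := (IsLengthCategory.hasCompositionSeries X).exists_hasLength
  induction n using Nat.strong_induction_on generalizing X with
  | _ n ih =>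
    refine h X fun Y i _ hi => ?_
    obtain ⟨m, -, hY, hm⟩ := hn.of_mono i
    exact ih m (hm hi) Y hY

/-- Induction over proper quotients. -/
theorem quotient_induction {P : A → Prop}
    (h : ∀ X : A, (∀ (Z : A) (p : X ⟶ Z) [Epi p], ¬ IsIso p → P Z) → P X) (X : A) : P X := by
  obtain ⟨n, hn⟩ := (IsLengthCategory.hasCompositionSeries X).exists_hasLength
  induction n using Nat.strong_induction_on generalizing X with
  | _ n ih =>
    refine h X fun Y i _ hi => ?_
    obtain ⟨m, -, hY, hm⟩ := hn.of_epi i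
    exact ih m (hm hi) Y hY

end Induction

/-! ### Torsion classes and torsion-free objects -/

namespace TorsionClass

theorem prop_of_epi (T : TorsionClass A) {X Y : A} (p : X ⟶ Y) [Epi p] (h : T.1 X) : T.1 Y :=
  T.2.quotients.prop_of_epi p h

theorem prop_of_isZero (T : TorsionClass A) {X : A} (h : IsZero X) : T.1 X := by
  have := T.2.containsZero
  have := T.2.quotients
  exact T.1.prop_of_isZero h

theorem prop_image (T : TorsionClass A) {X Y : A} (f : X ⟶ Y) (h : T.1 X) :
    T.1 (Abelian.image f) :=
  T.prop_of_epi (Abelian.factorThruImage f) h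

theorem mem_inf {T T' : TorsionClass A} {X : A} : (T ⊓ T').1 X ↔ T.1 X ∧ T'.1 X := by
  constructor
  · exact fun h => ⟨(inf_le_left : T ⊓ T' ≤ T) X h, (inf_le_right : T ⊓ T' ≤ T') X h⟩
  · rintro ⟨h, h'⟩ U (rfl | rfl)
    exacts [h, h']

theorem mem_sInf {s : Set (TorsionClass A)} {X : A} : (sInf s).1 X ↔ ∀ T ∈ s, T.1 X := Iff.rfl

/-- The class of all objects without nonzero morphisms to `M`. -/
def leftPerp (M : A) : TorsionClass A :=
  ⟨fun X => ∀ f : X ⟶ M, f = 0,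
    { containsZero := ⟨⟨_, isZero_zero A, fun _ => (isZero_zero A).eq_of_src _ _⟩⟩
      quotients := ⟨fun p _ hX f => by rw [← cancel_epi p, hX (p ≫ f), comp_zero]⟩
      extensions := ⟨fun {S} hS h₁ h₃ f => by
        obtain ⟨f', rfl⟩ := exists_desc hS f (h₁ _)
        rw [h₃ f', comp_zero]⟩ }⟩

theorem mem_leftPerp {M X : A} : (leftPerp M).1 X ↔ ∀ f : X ⟶ M, f = 0 := Iff.rfl

theorem isZero_of_mem_leftPerp_self {M : A} (h : (leftPerp M).1 M) : IsZero M :=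
  (IsZero.iff_id_eq_zero M).2 (h _)

/-- `X` is torsion-free: there is no nonzero morphism from an object of `T` to `X`. -/
def IsTorsionFree (T : TorsionClass A) (X : A) : Prop := T ≤ leftPerp X

theorem IsTorsionFree.isZero {T : TorsionClass A} {X : A} (h : T.IsTorsionFree X) (hX : T.1 X) :
    IsZero X := isZero_of_mem_leftPerp_self (h X hX)

theorem IsTorsionFree.of_mono {T : TorsionClass A} {X Y : A} (i : Y ⟶ X) [Mono i]
    (h : T.IsTorsionFree X) : T.IsTorsionFree Y := fun Z hZ f => by
  rw [← cancel_mono i, h Z hZ (f ≫ i), zero_comp]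

theorem exists_ne_zero_of_not_isTorsionFree {T : TorsionClass A} {X : A}
    (h : ¬ T.IsTorsionFree X) : ∃ (Y : A) (f : Y ⟶ X), T.1 Y ∧ f ≠ 0 := by
  by_contra! h'
  exact h fun Y hY f => h' Y f hY

/-- A nonzero object in a join receives a nonzero morphism from one of the joinands. -/
theorem exists_ne_zero_of_mem_sSup {s : Set (TorsionClass A)} {X : A} (hX : (sSup s).1 X)
    (h0 : ¬ IsZero X) : ∃ T ∈ s, ∃ (Y : A) (f : Y ⟶ X), T.1 Y ∧ f ≠ 0 := by
  by_contra! h'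
  have hle : sSup s ≤ leftPerp X := sSup_le fun T hT Y hY f => h' T hT Y f hY
  exact h0 (isZero_of_mem_leftPerp_self (hle X hX))

theorem eq_zero_of_isZero_image {X Y : A} (f : X ⟶ Y) (h : IsZero (Abelian.image f)) :
    f = 0 :=
  (image_ι_eq_zero_iff f).1 (h.eq_of_src _ _)

variable [IsLengthCategory A]

/-- An object outside of `T` has a nonzero torsion-free quotient. -/
theorem exists_isTorsionFree_quotient (T : TorsionClass A) {X : A} (hX : ¬ T.1 X) :
    ∃ (Z : A) (p : X ⟶ Z), Epi p ∧ ¬ IsZero Z ∧ T.IsTorsionFree Z := by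
  revert hX
  refine quotient_induction (P := fun X => ¬ T.1 X → ∃ (Z : A) (p : X ⟶ Z), Epi p ∧
    ¬ IsZero Z ∧ T.IsTorsionFree Z) (fun X ih hX => ?_) X
  by_cases hF : T.IsTorsionFree X
  · exact ⟨X, 𝟙 X, inferInstance, fun h => hX (T.prop_of_isZero h), hF⟩
  obtain ⟨Y, f, hY, hf⟩ := exists_ne_zero_of_not_isTorsionFree hF
  have hι : Abelian.image.ι f ≠ 0 := fun h => hf ((image_ι_eq_zero_iff f).1 h)
  obtain ⟨Z, p, _, hZ, hZF⟩ := ih _ (cokernel.π (Abelian.image.ι f)) (not_isIso_cokernel_π hι)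
    fun h => hX (prop_of_mono_of_cokernel T.2.extensions (Abelian.image.ι f) (T.prop_image f hY) h)
  exact ⟨Z, cokernel.π (Abelian.image.ι f) ≫ p, inferInstance, hZ, hZF⟩

theorem le_of_isTorsionFree {T T' : TorsionClass A}
    (h : ∀ X, T'.IsTorsionFree X → T.IsTorsionFree X) : T ≤ T' := by
  intro X hX
  by_contra hX'
  obtain ⟨Z, p, _, hZ, hF⟩ := T'.exists_isTorsionFree_quotient hX'
  exact hZ ((h Z hF).isZero (T.prop_of_epi p hX))

/-- Compare torsion-free objects, and take `M` with all proper subobjects torsion-free for `U` but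
`M` itself not. Then `M` lies in `U`. Being nonzero and torsion-free for `sInf s`, it lies outside
some `x ∈ s`. Images of objects of `x` in `M` are proper and in `U`, hence zero. So `M` is
torsion-free for `T` and `x`, thus for `U`. -/
theorem sup_sInf_of_forall_sup_eq {T U : TorsionClass A} {s : Set (TorsionClass A)}
    (hs : s.Nonempty) (h : ∀ x ∈ s, T ⊔ x = U) : T ⊔ sInf s = U := by
  obtain ⟨x₀, hx₀⟩ := hs
  have hsU : ∀ x ∈ s, x ≤ U := fun x hx => h x hx ▸ le_sup_right
  refine le_antisymm (sup_le (h x₀ hx₀ ▸ le_sup_left) ((sInf_le hx₀).trans (hsU x₀ hx₀))) ?_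
  refine le_of_isTorsionFree fun M => subobject_induction (P := fun M =>
    (T ⊔ sInf s).IsTorsionFree M → U.IsTorsionFree M) (fun M ih hM => ?_) M
  by_contra hMU
  have ih' : ∀ (Y : A) (i : Y ⟶ M) [Mono i], ¬ IsIso i → U.IsTorsionFree Y :=
    fun Y i _ hi => ih Y i hi (hM.of_mono i)
  obtain ⟨Y, f, hY, hf⟩ := exists_ne_zero_of_not_isTorsionFree hMU
  have hUM : U.1 M := by
    by_cases hi : IsIso (Abelian.image.ι f)
    · exact U.prop_of_epi (Abelian.image.ι f) (U.prop_image f hY)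
    · exact (hf (eq_zero_of_isZero_image f
        ((ih' _ (Abelian.image.ι f) hi).isZero (U.prop_image f hY)))).elim
  have hM0 : ¬ IsZero M := fun h => hf (h.eq_of_tgt _ _)
  have hMs : ¬ (sInf s).1 M := fun h =>
    hM0 (IsTorsionFree.isZero (T := sInf s) (le_sup_right.trans hM) h)
  rw [mem_sInf] at hMs
  push Not at hMs
  obtain ⟨x, hx, hxM⟩ := hMs
  have hxF : x.IsTorsionFree M := by
    intro Z hZ g
    have hi : ¬ IsIso (Abelian.image.ι g) := fun hi =>
      hxM (x.prop_of_epi (Abelian.image.ι g) (x.prop_image g hZ))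
    exact eq_zero_of_isZero_image g
      ((ih' _ (Abelian.image.ι g) hi).isZero (hsU x hx _ (x.prop_image g hZ)))
  apply hMU
  rw [← h x hx]
  exact sup_le (le_sup_left.trans hM) hxF

theorem inf_sSup_of_forall_inf_eq {T U : TorsionClass A} {s : Set (TorsionClass A)}
    (hs : s.Nonempty) (h : ∀ x ∈ s, T ⊓ x = U) : T ⊓ sSup s = U := by
  obtain ⟨x₀, hx₀⟩ := hs
  have hUs : ∀ x ∈ s, U ≤ x := fun x hx => h x hx ▸ inf_le_right
  refine le_antisymm ?_ (le_inf (h x₀ hx₀ ▸ inf_le_left) ((hUs x₀ hx₀).trans (le_sSup hx₀)))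
  intro M
  refine quotient_induction (P := fun M => (T ⊓ sSup s).1 M → U.1 M) (fun M ih hM => ?_) M
  by_cases hM0 : IsZero M
  · exact U.prop_of_isZero hM0
  obtain ⟨x, hx, Y, f, hY, hf⟩ := exists_ne_zero_of_mem_sSup (mem_inf.1 hM).2 hM0
  have hι : Abelian.image.ι f ≠ 0 := fun h => hf ((image_ι_eq_zero_iff f).1 h)
  -- By induction the cokernel is in `U ≤ x`, and the image is in `x`; hence `M`, an extension of
  -- the two, is in `x`.
  have hC : U.1 (cokernel (Abelian.image.ι f)) :=
    ih _ (cokernel.π (Abelian.image.ι f)) (not_isIso_cokernel_π hι)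
      ((T ⊓ sSup s).prop_of_epi (cokernel.π (Abelian.image.ι f)) hM)
  rw [← h x hx]
  exact mem_inf.2 ⟨(mem_inf.1 hM).1, prop_of_mono_of_cokernel x.2.extensions
    (Abelian.image.ι f) (x.prop_image f hY) (hUs x hx _ hC)⟩

variable (A) in
theorem isCompletelySemidistributive : IsCompletelySemidistributive (TorsionClass A) where
  sup_sInf _ _ _ := sup_sInf_of_forall_sup_eq
  inf_sSup _ _ _ := inf_sSup_of_forall_inf_eq

end TorsionClass

/-! ### Kernels and cokernels of a morphism out of an extension -/

/-- If `f` is a morphism out of an extension of `X₃` by `X₁`, then `kernel f` is an extension of the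
kernel of the induced morphism out of `X₃` by the kernel of the restriction of `f` to `X₁`. -/
theorem prop_kernel_of_shortExact {P : ObjectProperty A} (hP : P.IsClosedUnderExtensions)
    {S : ShortComplex A} (hS : S.ShortExact) {M : A} (f : S.X₂ ⟶ M)
    (f₃ : S.X₃ ⟶ cokernel (S.f ≫ f)) (hf : S.g ≫ f₃ = f ≫ cokernel.π (S.f ≫ f))
    (h₁ : P (kernel (S.f ≫ f))) (h₃ : P (kernel f₃)) : P (kernel f) := by
  have := hS.mono_f
  have := hS.epi_g
  let a : kernel (S.f ≫ f) ⟶ kernel f := kernel.lift f (kernel.ι _ ≫ S.f)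
    (by rw [Category.assoc, kernel.condition])
  let b : kernel f ⟶ kernel f₃ := kernel.lift f₃ (kernel.ι f ≫ S.g)
    (by rw [Category.assoc, hf, kernel.condition_assoc, zero_comp])
  have ha : a ≫ kernel.ι f = kernel.ι _ ≫ S.f := kernel.lift_ι _ _ _
  have hb : b ≫ kernel.ι f₃ = kernel.ι f ≫ S.g := kernel.lift_ι _ _ _
  have hab : a ≫ b = 0 := by
    rw [← cancel_mono (kernel.ι f₃), Category.assoc, hb, reassoc_of% ha, S.zero, comp_zero,
      zero_comp]
  have : Mono a := by
    have : Mono (a ≫ kernel.ι f) := ha ▸ inferInstance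
    exact mono_of_mono a (kernel.ι f)
  have : Epi b := by
    rw [epi_iff_surjective_up_to_refinements]
    intro B y
    obtain ⟨B', π, _, x, hx⟩ := surjective_up_to_refinements_of_epi S.g (y ≫ kernel.ι f₃)
    have hx0 : (x ≫ f) ≫ cokernel.π (S.f ≫ f) = 0 := by
      rw [Category.assoc, ← hf, ← reassoc_of% hx, kernel.condition, comp_zero, comp_zero]
    obtain ⟨B'', π', _, z, hz⟩ :=
      (ShortComplex.exact_cokernel (S.f ≫ f)).exact_up_to_refinements (x ≫ f) hx0
    dsimp at hz
    -- The lift `x` of `y` is corrected by an element of `S.X₁` with the same image under `f`, which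
    -- makes it lie in the kernel of `f`.
    refine ⟨B'', π' ≫ π, inferInstance,
      kernel.lift f (π' ≫ x - z ≫ S.f) (by simp [hz]), ?_⟩
    rw [← cancel_mono (kernel.ι f₃), Category.assoc _ b, hb, kernel.lift_ι_assoc]
    simp [hx]
  refine hP.prop_X₂_of_shortExact (S := ShortComplex.mk a b hab) { exact := ?_ } h₁ h₃
  rw [ShortComplex.exact_iff_exact_up_to_refinements]
  intro B y hy
  dsimp at y hy
  obtain ⟨z, hz⟩ := exists_lift hS (y ≫ kernel.ι f)
    (by rw [Category.assoc, ← hb, reassoc_of% hy, zero_comp])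
  refine ⟨B, 𝟙 B, inferInstance, kernel.lift _ z
    (by rw [reassoc_of% hz, kernel.condition, comp_zero]), ?_⟩
  dsimp
  rw [← cancel_mono (kernel.ι f), Category.assoc, Category.assoc, ha, kernel.lift_ι_assoc, hz,
    Category.id_comp]

theorem epi_kernel_lift_comp {X Y Z : A} (p : X ⟶ Y) [Epi p] (f : Y ⟶ Z) :
    Epi (kernel.lift f (kernel.ι (p ≫ f) ≫ p) (by rw [Category.assoc, kernel.condition])) := by
  rw [epi_iff_surjective_up_to_refinements]
  intro B y
  obtain ⟨B', π, _, x, hx⟩ := surjective_up_to_refinements_of_epi p (y ≫ kernel.ι f)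
  refine ⟨B', π, inferInstance, kernel.lift _ x
    (by rw [← reassoc_of% hx, kernel.condition, comp_zero, comp_zero]), ?_⟩
  rw [← cancel_mono (kernel.ι f)]
  simp [hx]

/-- In the situation of `prop_kernel_of_shortExact`, the morphisms `f` and `f₃` have
the same cokernel. -/
def cokernelIsoOfShortExact {S : ShortComplex A} [Epi S.g] {M : A} (f : S.X₂ ⟶ M)
    (f₃ : S.X₃ ⟶ cokernel (S.f ≫ f)) (hf : S.g ≫ f₃ = f ≫ cokernel.π (S.f ≫ f)) :
    cokernel f₃ ≅ cokernel f where
  hom := cokernel.desc _ (cokernel.desc _ (cokernel.π f)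
      (by rw [Category.assoc, cokernel.condition, comp_zero]))
    (by rw [← cancel_epi S.g, reassoc_of% hf, cokernel.π_desc, cokernel.condition, comp_zero])
  inv := cokernel.desc _ (cokernel.π _ ≫ cokernel.π f₃)
    (by rw [← reassoc_of% hf, cokernel.condition, comp_zero])

/-- An object `K` over `X` through which `kernel.ι g` factors, and on which `g` vanishes, has
`kernel g` as a quotient. -/
theorem prop_kernel_of_factors {P : ObjectProperty A} (hP : P.IsClosedUnderQuotients) {K X Y : A}
    (g : X ⟶ Y) (k : K ⟶ X) (hk : k ≫ g = 0) (s : kernel g ⟶ K) (hs : s ≫ k = kernel.ι g)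
    (hK : P K) : P (kernel g) := by
  have h : s ≫ kernel.lift g k hk = 𝟙 _ := by
    rw [← cancel_mono (kernel.ι g), Category.assoc, kernel.lift_ι, hs, Category.id_comp]
  have : IsSplitEpi (kernel.lift g k hk) := ⟨⟨⟨s, h⟩⟩⟩
  exact hP.prop_of_epi (kernel.lift g k hk) hK

/-! ### Torsion closures and bricks -/

open TorsionClass

theorem torsionClosure_le_iff {P : ObjectProperty A} {T : TorsionClass A} :
    torsionClosure P ≤ T ↔ P ≤ T.1 :=
  ⟨fun h X hX => h X (mem_sInf.2 fun _ hU => hU X hX), fun h => sInf_le h⟩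

theorem le_torsionClosure (P : ObjectProperty A) : P ≤ (torsionClosure P).1 :=
  torsionClosure_le_iff.1 le_rfl

/-- The torsion class generated by an object. -/
def torsionClosureObj (B : A) : TorsionClass A := torsionClosure (fun Y => Y = B)

theorem torsionClosureObj_le_iff {B : A} {T : TorsionClass A} :
    torsionClosureObj B ≤ T ↔ T.1 B := by
  refine torsionClosure_le_iff.trans ⟨fun h => h B rfl, ?_⟩
  rintro h _ rfl
  exact h

theorem mem_torsionClosureObj (B : A) : (torsionClosureObj B).1 B :=
  torsionClosureObj_le_iff.1 le_rfl

/-- A brick is a nonzero object all of whose nonzero endomorphisms are invertible. -/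
structure IsBrick (B : A) : Prop where
  not_isZero : ¬ IsZero B
  isIso_of_ne_zero : ∀ f : B ⟶ B, f ≠ 0 → IsIso f

/-- The class of all objects with only zero morphisms and epimorphisms to `B`. -/
def zeroOrEpiClass (B : A) : TorsionClass A :=
  ⟨fun X => ∀ f : X ⟶ B, f ≠ 0 → Epi f,
    { containsZero := ⟨⟨_, isZero_zero A, fun _ hf => (hf ((isZero_zero A).eq_of_src _ _)).elim⟩⟩
      quotients := ⟨fun p _ hX f hf => by
        have : Epi (p ≫ f) := hX (p ≫ f) fun h => hf (by rw [← cancel_epi p, h, comp_zero])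
        exact epi_of_epi p f⟩
      extensions := ⟨fun {S} hS h₁ h₃ f hf => by
        have := hS.epi_g
        by_cases h : S.f ≫ f = 0
        · obtain ⟨f', rfl⟩ := exists_desc hS f h
          have : Epi f' := h₃ f' fun h => hf (by rw [h, comp_zero])
          infer_instance
        · have : Epi (S.f ≫ f) := h₁ _ h
          exact epi_of_epi S.f f⟩ }⟩

namespace IsBrick

variable {B : A} (hB : IsBrick B)
include hB

theorem torsionClosureObj_le_zeroOrEpiClass : torsionClosureObj B ≤ zeroOrEpiClass B :=
  torsionClosureObj_le_iff.2 fun f hf => by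
    have := hB.isIso_of_ne_zero f hf
    infer_instance

theorem epi_of_ne_zero {Y : A} (hY : (torsionClosureObj B).1 Y) {f : Y ⟶ B} (hf : f ≠ 0) : Epi f :=
  hB.torsionClosureObj_le_zeroOrEpiClass Y hY f hf

theorem mem_leftPerp_of_epi {Z : A} (p : B ⟶ Z) [Epi p] (hp : ¬ IsIso p) : (leftPerp B).1 Z := by
  intro f
  by_contra hf
  have : IsIso (p ≫ f) := hB.isIso_of_ne_zero _ fun h => hf (by rw [← cancel_epi p, h, comp_zero])
  have : Mono p := mono_of_mono p f
  exact hp (isIso_of_mono_of_epi p)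

theorem not_mem_leftPerp : ¬ (leftPerp B).1 B := fun h =>
  hB.not_isZero (isZero_of_mem_leftPerp_self h)

/-- A nonzero morphism to `B` from an object of `x < T(B)` would be epi, putting `B` into `x`. -/
theorem lowerStar_torsionClosureObj :
    lowerStar (torsionClosureObj B) = torsionClosureObj B ⊓ leftPerp B := by
  have hlt : torsionClosureObj B ⊓ leftPerp B < torsionClosureObj B :=
    lt_of_le_of_ne inf_le_left fun h =>
      hB.not_mem_leftPerp (inf_eq_left.1 h _ (mem_torsionClosureObj B))
  refine le_antisymm (sSup_le fun x (hx : x < _) => le_inf hx.le fun Y hY f => ?_) (le_sSup hlt)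
  by_contra hf
  have := hB.epi_of_ne_zero (hx.le Y hY) hf
  exact hx.not_ge (torsionClosureObj_le_iff.2 (x.prop_of_epi f hY))

/-- If an object of `x` had a nonzero image in `B`, the cokernel, a proper quotient of a brick,
would lie in the lower star and hence in `x`. By extension `B` would be in `x`, which is impossible.
-/
theorem kappa_torsionClosureObj : kappa (torsionClosureObj B) = leftPerp B := by
  refine le_antisymm (sSup_le fun x hx => ?_) (le_sSup hB.lowerStar_torsionClosureObj.symm)
  rw [Set.mem_ofPred_eq, hB.lowerStar_torsionClosureObj] at hx
  have hBx : ¬ x.1 B := fun h => hB.not_mem_leftPerp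
    (mem_inf.1 (hx ▸ mem_inf.2 ⟨mem_torsionClosureObj B, h⟩ :
      (torsionClosureObj B ⊓ leftPerp B).1 B)).2
  intro Y hY f
  by_contra hf
  have hι : Abelian.image.ι f ≠ 0 := fun h => hf ((image_ι_eq_zero_iff f).1 h)
  have hC : (torsionClosureObj B ⊓ leftPerp B).1 (cokernel (Abelian.image.ι f)) :=
    mem_inf.2 ⟨prop_of_epi _ (cokernel.π (Abelian.image.ι f)) (mem_torsionClosureObj B),
      hB.mem_leftPerp_of_epi (cokernel.π (Abelian.image.ι f)) (not_isIso_cokernel_π hι)⟩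
  rw [← hx] at hC
  exact hBx (prop_of_mono_of_cokernel x.2.extensions (Abelian.image.ι f) (x.prop_image f hY)
    (mem_inf.1 hC).2)

end IsBrick

/-! ### Wide subcategories -/

namespace IsWideSubcategory

variable {W : ObjectProperty A} (hW : IsWideSubcategory W)
include hW

theorem prop_of_iso {X Y : A} (e : X ≅ Y) (h : W X) : W Y := hW.isos.of_iso e h

theorem prop_of_isZero {X : A} (h : IsZero X) : W X := by
  have := hW.isos
  have := hW.containsZero
  exact W.prop_of_isZero h

theorem prop_kernel {X Y : A} (f : X ⟶ Y) (hX : W X) (hY : W Y) : W (kernel f) :=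
  have := hW.kernels
  W.prop_kernel f hX hY

theorem prop_cokernel {X Y : A} (f : X ⟶ Y) (hX : W X) (hY : W Y) : W (cokernel f) :=
  have := hW.cokernels
  W.prop_cokernel f hX hY

theorem prop_image_of_prop_cokernel {X Y : A} (f : X ⟶ Y) (hY : W Y) (h : W (cokernel f)) :
    W (Abelian.image f) :=
  -- `Abelian.image f` is by definition the kernel of `cokernel.π f`.
  hW.prop_kernel (cokernel.π f) hY h

/-- The class of all objects `X` such that every morphism from `X` to an object of `W` has
its cokernel in `W` and its kernel in the torsion closure of `W`. -/
def admissibleClass : TorsionClass A :=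
  ⟨fun X => ∀ ⦃M : A⦄ (_ : W M) (f : X ⟶ M), W (cokernel f) ∧ (torsionClosure W).1 (kernel f),
    { containsZero := ⟨⟨_, isZero_zero A, fun M hM f => by
        obtain rfl : f = 0 := (isZero_zero A).eq_of_src _ _
        exact ⟨hW.prop_of_iso cokernelZeroIsoTarget.symm hM,
          TorsionClass.prop_of_isZero _ (IsZero.of_mono (kernel.ι _) (isZero_zero A))⟩⟩⟩
      quotients := ⟨fun {X Y} p _ hX M hM f => by
        obtain ⟨hc, hk⟩ := hX hM (p ≫ f)
        refine ⟨hW.prop_of_iso (cokernelEpiComp p f) hc, ?_⟩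
        have := epi_kernel_lift_comp p f
        exact TorsionClass.prop_of_epi _ (kernel.lift f (kernel.ι (p ≫ f) ≫ p) _) hk⟩
      extensions := ⟨fun {S} hS h₁ h₃ M hM f => by
        have := hS.epi_g
        obtain ⟨hc₁, hk₁⟩ := h₁ hM (S.f ≫ f)
        obtain ⟨f₃, hf⟩ := exists_desc hS (f ≫ cokernel.π (S.f ≫ f))
          (by rw [← Category.assoc, cokernel.condition])
        -- The target of `f₃` is again in `W`: this is why the class also controls cokernels.
        obtain ⟨hc₃, hk₃⟩ := h₃ hc₁ f₃
        exact ⟨hW.prop_of_iso (cokernelIsoOfShortExact f f₃ hf) hc₃,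
          prop_kernel_of_shortExact (torsionClosure W).2.extensions hS f f₃ hf hk₁ hk₃⟩⟩ }⟩

theorem torsionClosure_le_admissibleClass : torsionClosure W ≤ hW.admissibleClass :=
  torsionClosure_le_iff.2 fun _ hX _ hM f =>
    ⟨hW.prop_cokernel f hX hM, le_torsionClosure W _ (hW.prop_kernel f hX hM)⟩

theorem prop_image {X M : A} (hX : (torsionClosure W).1 X) (hM : W M) (f : X ⟶ M) :
    W (Abelian.image f) :=
  hW.prop_image_of_prop_cokernel f hM (hW.torsionClosure_le_admissibleClass X hX hM f).1

theorem torsionClosure_kernel {X M : A} (hX : (torsionClosure W).1 X) (hM : W M) (f : X ⟶ M) :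
    (torsionClosure W).1 (kernel f) :=
  (hW.torsionClosure_le_admissibleClass X hX hM f).2

end IsWideSubcategory

/-- `B` is a simple object of the subcategory `W`. -/
structure IsSimpleIn (W : ObjectProperty A) (B : A) : Prop where
  prop : W B
  not_isZero : ¬ IsZero B
  isIso_of_mono : ∀ ⦃Y : A⦄ (i : Y ⟶ B) [Mono i], W Y → i ≠ 0 → IsIso i

theorem exists_isSimpleIn_mono [IsLengthCategory A] {W : ObjectProperty A} {X : A} (hX : W X) (h0 : ¬ IsZero X) :
    ∃ (B : A) (i : B ⟶ X), Mono i ∧ IsSimpleIn W B := by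
  revert hX h0
  refine subobject_induction (P := fun X => W X → ¬ IsZero X →
    ∃ (B : A) (i : B ⟶ X), Mono i ∧ IsSimpleIn W B) (fun X ih hX h0 => ?_) X
  by_cases hs : IsSimpleIn W X
  · exact ⟨X, 𝟙 X, inferInstance, hs⟩
  have : ∃ (Y : A) (i : Y ⟶ X), Mono i ∧ W Y ∧ i ≠ 0 ∧ ¬ IsIso i := by
    by_contra! h
    exact hs ⟨hX, h0, fun Y i hi hY hne => h Y i hi hY hne⟩
  obtain ⟨Y, i, _, hY, hi, hiso⟩ := this
  obtain ⟨B, j, _, hB⟩ := ih Y i hiso hY fun h => hi (h.eq_of_src _ _)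
  exact ⟨B, j ≫ i, inferInstance, hB⟩

namespace IsWideSubcategory

variable {W : ObjectProperty A} (hW : IsWideSubcategory W)

section

include hW

theorem epi_of_isSimpleIn {X B : A} (hX : (torsionClosure W).1 X) (hB : IsSimpleIn W B)
    {f : X ⟶ B} (hf : f ≠ 0) : Epi f := by
  have := hB.isIso_of_mono (Abelian.image.ι f) (hW.prop_image hX hB.prop f)
    fun h => hf ((image_ι_eq_zero_iff f).1 h)
  exact epi_of_isIso_image_ι f

/-- Schur's lemma inside `W`. -/
theorem isIso_of_isSimpleIn {B B' : A} (hB : IsSimpleIn W B) (hB' : IsSimpleIn W B')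
    {f : B ⟶ B'} (hf : f ≠ 0) : IsIso f := by
  have := hW.epi_of_isSimpleIn (le_torsionClosure W _ hB.prop) hB' hf
  have : Mono f := by
    refine Preadditive.mono_of_kernel_zero ?_
    by_contra h
    exact not_isIso_kernel_ι hf
      (hB.isIso_of_mono (kernel.ι f) (hW.prop_kernel f hB.prop hB'.prop) h)
  exact isIso_of_mono_of_epi f

theorem isBrick_of_isSimpleIn {B : A} (hB : IsSimpleIn W B) : IsBrick B :=
  ⟨hB.not_isZero, fun _ hf => hW.isIso_of_isSimpleIn hB hB hf⟩

/-- A wide subcategory is the extension closure of its simple objects. -/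
theorem le_of_isSimpleIn [IsLengthCategory A] {P : ObjectProperty A}
    (hP : P.IsClosedUnderExtensions) (h0 : ∀ X, IsZero X → P X)
    (hs : ∀ B, IsSimpleIn W B → P B) : W ≤ P := by
  intro X
  refine quotient_induction (P := fun X => W X → P X) (fun X ih hX => ?_) X
  by_cases hX0 : IsZero X
  · exact h0 X hX0
  obtain ⟨B, i, _, hB⟩ := exists_isSimpleIn_mono hX hX0
  have hi : i ≠ 0 := fun h => hB.not_isZero (IsZero.of_mono_eq_zero i h)
  exact prop_of_mono_of_cokernel hP i (hs B hB)
    (ih _ (cokernel.π i) (not_isIso_cokernel_π hi) (hW.prop_cokernel i hB.prop hX))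

/-- If T(W) is the join of `s`, a simple object `B` of `W` receives a nonzero morphism from a member
of `s`; it is epi, so `B` is in that member. An inclusion T(B) ≤ T(B') yields a nonzero morphism `B'
⟶ B`, invertible by Schur. -/
theorem isCanonicalJoinRep [IsLengthCategory A] :
    IsCanonicalJoinRep (torsionClosure W) (torsionClosureObj '' {B | IsSimpleIn W B}) where
  eq_sSup := by
    refine le_antisymm (torsionClosure_le_iff.2 ?_) (sSup_le ?_)
    · exact hW.le_of_isSimpleIn (sSup (torsionClosureObj '' {B | IsSimpleIn W B})).2.extensions
        (fun X hX => TorsionClass.prop_of_isZero _ hX)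
        fun B hB => (le_sSup (Set.mem_image_of_mem _ hB) : torsionClosureObj B ≤ _) B
          (mem_torsionClosureObj B)
    · rintro _ ⟨B, hB, rfl⟩
      exact torsionClosureObj_le_iff.2 (le_torsionClosure W B hB.prop)
  refines := by
    rintro s hs _ ⟨B, hB, rfl⟩
    have hBs : (sSup s).1 B := hs ▸ le_torsionClosure W B hB.prop
    obtain ⟨T, hT, Y, f, hY, hf⟩ := exists_ne_zero_of_mem_sSup hBs hB.not_isZero
    have hYW : (torsionClosure W).1 Y := by
      rw [hs]
      exact (le_sSup hT : T ≤ sSup s) Y hY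
    have := hW.epi_of_isSimpleIn hYW hB hf
    exact ⟨T, hT, torsionClosureObj_le_iff.2 (T.prop_of_epi f hY)⟩
  antichain := by
    rintro _ ⟨B, hB, rfl⟩ _ ⟨B', hB', rfl⟩ h
    refine le_antisymm h (torsionClosureObj_le_iff.2 ?_)
    have : ¬ ∀ f : B' ⟶ B, f = 0 := fun h' => hB.not_isZero (isZero_of_mem_leftPerp_self
      (h.trans (torsionClosureObj_le_iff.2 h') B (mem_torsionClosureObj B)))
    push Not at this
    obtain ⟨f, hf⟩ := this
    have := hW.isIso_of_isSimpleIn hB' hB hf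
    exact TorsionClass.prop_of_epi _ (inv f) (mem_torsionClosureObj B)

theorem mem_sInf_kappa_iff [IsLengthCategory A] {X : A} :
    (sInf (kappa '' (torsionClosureObj '' {B | IsSimpleIn W B}))).1 X ↔
      ∀ M, W M → ∀ f : X ⟶ M, f = 0 := by
  constructor
  · intro h
    refine hW.le_of_isSimpleIn (P := fun M => ∀ f : X ⟶ M, f = 0) ⟨fun {S} hS h₁ h₃ f => ?_⟩
      (fun M hM f => hM.eq_of_tgt _ _) fun B hB => ?_
    · obtain ⟨f', rfl⟩ := exists_lift hS f (h₃ _)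
      rw [h₁ f', zero_comp]
    · rw [← mem_leftPerp, ← (hW.isBrick_of_isSimpleIn hB).kappa_torsionClosureObj]
      exact h _ ⟨_, ⟨B, hB, rfl⟩, rfl⟩
  · rintro h _ ⟨_, ⟨B, hB, rfl⟩, rfl⟩
    rw [(hW.isBrick_of_isSimpleIn hB).kappa_torsionClosureObj]
    exact h B hB.prop

/-- An object of the torsion closure of `W` belongs to `W` if it receives only zero morphisms from
the objects without nonzero morphisms to `W`. -/
theorem prop_of_torsionClosure [IsLengthCategory A] {X : A} (hX : (torsionClosure W).1 X)
    (h : ∀ (Y : A) (i : Y ⟶ X), (∀ M, W M → ∀ f : Y ⟶ M, f = 0) → i = 0) : W X := by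
  revert hX h
  refine subobject_induction (P := fun X => (torsionClosure W).1 X →
    (∀ (Y : A) (i : Y ⟶ X), (∀ M, W M → ∀ f : Y ⟶ M, f = 0) → i = 0) → W X)
    (fun X ih hX h => ?_) X
  by_cases hX0 : IsZero X
  · exact hW.prop_of_isZero hX0
  have : ¬ ∀ M, W M → ∀ f : X ⟶ M, f = 0 := fun h' =>
    hX0 ((IsZero.iff_id_eq_zero X).2 (h X (𝟙 X) h'))
  push Not at this
  obtain ⟨M, hM, f, hf⟩ := this
  -- The image of `f` is in `W`; the kernel stays in T(W) and inherits the vanishing hypothesis, so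
  -- induction applies to it.
  refine prop_of_epi_of_kernel hW.extensions (Abelian.factorThruImage f) ?_ (hW.prop_image hX hM f)
  have hf' : Abelian.factorThruImage f ≠ 0 := fun h => hf (by
    rw [← Abelian.image.fac f, h, zero_comp])
  refine ih _ (kernel.ι _) (not_isIso_kernel_ι hf')
    (hW.torsionClosure_kernel hX (hW.prop_image hX hM f) _) fun Y i hY => ?_
  rw [← cancel_mono (kernel.ι _), h Y (i ≫ kernel.ι _) hY, zero_comp]

end

end IsWideSubcategory

/-! ### The wide subcategory of a torsion class -/

/-- The objects `X` of `T` such that all morphisms from objects of `T` to `X` have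
their kernel in `T`. -/
def wideCore (T : TorsionClass A) : ObjectProperty A :=
  fun X => T.1 X ∧ ∀ ⦃Y : A⦄ (_ : T.1 Y) (g : Y ⟶ X), T.1 (kernel g)

theorem isWideSubcategory_wideCore (T : TorsionClass A) : IsWideSubcategory (wideCore T) where
  isos := ⟨fun {X X'} e hX => ⟨T.prop_of_epi e.hom hX.1, fun Y hY g =>
    prop_kernel_of_factors T.2.quotients g (kernel.ι (g ≫ e.inv))
      (by rw [← cancel_mono e.inv, Category.assoc, kernel.condition, zero_comp])
      (kernel.lift _ (kernel.ι g) (by rw [kernel.condition_assoc, zero_comp]))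
      (kernel.lift_ι _ _ _) (hX.2 hY (g ≫ e.inv))⟩⟩
  containsZero := ⟨⟨_, isZero_zero A, T.prop_of_isZero (isZero_zero A), fun Y hY g =>
    prop_kernel_of_factors T.2.quotients g (𝟙 Y) ((isZero_zero A).eq_of_tgt _ _) (kernel.ι g)
      (Category.comp_id _) hY⟩⟩
  extensions := ⟨fun {S} hS h₁ h₃ => by
    have := hS.mono_f
    refine ⟨T.2.extensions.prop_X₂_of_shortExact hS h₁.1 h₃.1, fun Y hY g => ?_⟩
    obtain ⟨l, hl⟩ := exists_lift hS (kernel.ι (g ≫ S.g) ≫ g)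
      (by rw [Category.assoc, kernel.condition])
    refine prop_kernel_of_factors T.2.quotients g (kernel.ι l ≫ kernel.ι (g ≫ S.g))
      (by rw [Category.assoc, ← hl, kernel.condition_assoc, zero_comp])
      (kernel.lift l (kernel.lift (g ≫ S.g) (kernel.ι g)
        (by rw [kernel.condition_assoc, zero_comp])) ?_)
      (by rw [kernel.lift_ι_assoc, kernel.lift_ι]) (h₁.2 (h₃.2 hY _) l)
    rw [← cancel_mono S.f, Category.assoc, hl, kernel.lift_ι_assoc, kernel.condition, zero_comp]⟩
  kernels := ⟨by
    rintro _ ⟨f, k, hk, hX, hX'⟩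
    have : Mono k.ι := mono_of_isLimit_fork hk
    let e : kernel f ≅ k.pt := (kernelIsKernel f).conePointUniqueUpToIso hk
    refine ⟨T.prop_of_epi e.hom (hX'.2 hX.1 f), fun Y hY g => ?_⟩
    refine prop_kernel_of_factors T.2.quotients g (kernel.ι (g ≫ k.ι)) ?_
      (kernel.lift _ (kernel.ι g) (by rw [kernel.condition_assoc, zero_comp]))
      (kernel.lift_ι _ _ _) (hX.2 hY (g ≫ k.ι))
    rw [← cancel_mono k.ι, Category.assoc, kernel.condition, zero_comp]⟩
  cokernels := ⟨by
    rintro _ ⟨f, c, hc, hX, hX'⟩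
    have : Epi c.π := epi_of_isColimit_cofork hc
    refine ⟨T.prop_of_epi c.π hX'.1, fun Y hY g => ?_⟩
    -- `E ⟶ X'` has the same kernel as `g`, and `E` is in `T` as an extension of `Y` by a quotient
    -- of `X`.
    let E := pullback g c.π
    have hker : T.1 (kernel c.π) := by
      have hex : (ShortComplex.mk f c.π c.condition).Exact :=
        ShortComplex.exact_of_g_is_cokernel _ (hc.ofIsoColimit (Cofork.ext (Iso.refl _)))
      have : Epi (kernel.lift c.π f c.condition) := hex.epi_kernelLift
      exact T.prop_of_epi (kernel.lift c.π f c.condition) hX.1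
    have hE : T.1 E := by
      refine prop_of_epi_of_kernel T.2.extensions (pullback.fst g c.π) ?_ hY
      refine prop_kernel_of_factors T.2.quotients (pullback.fst g c.π)
        (pullback.lift 0 (kernel.ι c.π) (by rw [kernel.condition, zero_comp]))
        (pullback.lift_fst _ _ _)
        (kernel.lift c.π (kernel.ι _ ≫ pullback.snd g c.π) ?_) ?_ hker
      · rw [Category.assoc, ← pullback.condition, kernel.condition_assoc, zero_comp]
      · apply pullback.hom_ext
        · rw [Category.assoc, pullback.lift_fst, comp_zero, kernel.condition]
        · rw [Category.assoc, pullback.lift_snd, kernel.lift_ι]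
    refine prop_kernel_of_factors T.2.quotients g
      (kernel.ι (pullback.snd g c.π) ≫ pullback.fst g c.π) ?_
      (kernel.lift _ (pullback.lift (kernel.ι g) 0 (by rw [kernel.condition, zero_comp]))
        (pullback.lift_snd _ _ _)) (by rw [kernel.lift_ι_assoc, pullback.lift_fst]) (hX'.2 hE _)
    rw [Category.assoc, pullback.condition, kernel.condition_assoc, zero_comp]⟩

theorem torsionClosure_wideCore_le (T : TorsionClass A) : torsionClosure (wideCore T) ≤ T :=
  torsionClosure_le_iff.2 fun _ hX => hX.1

theorem isIso_of_mono_endomorphism [IsLengthCategory A] {X : A} (f : X ⟶ X) [Mono f] :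
    IsIso f := by
  classical
  by_contra hf
  have h := (IsLengthCategory.hasCompositionSeries X).exists_hasLength
  obtain ⟨m, -, hm, hlt⟩ := (Nat.find_spec h).of_mono f
  exact Nat.find_min h (hlt hf) hm

/-! ### Completely join-irreducible torsion classes -/

/-- Take `B` in `j` outside the lower star with all proper quotients inside it. Then `B` is
torsion-free for the lower star, so the image of a nonzero endomorphism cannot be a proper quotient.
Such an endomorphism is mono, hence invertible by finite length. As `B` is not in the lower star,
T(B) is not strictly below `j`. -/
theorem exists_isBrick_of_isCompletelyJoinIrreducible [IsLengthCategory A] {j : TorsionClass A}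
    (hj : IsCompletelyJoinIrreducible j) : ∃ B, IsBrick B ∧ j = torsionClosureObj B := by
  have hlt : lowerStar j < j := by
    refine lt_of_le_of_ne (sSup_le fun x hx => le_of_lt hx) fun h => ?_
    exact lt_irrefl j (hj _ h.symm)
  have hex : ∃ M, j.1 M ∧ ¬ (lowerStar j).1 M ∧
      ∀ (Z : A) (p : M ⟶ Z) [Epi p], ¬ IsIso p → (lowerStar j).1 Z := by
    by_contra! h
    refine hlt.not_ge fun M => quotient_induction (P := fun M => j.1 M → (lowerStar j).1 M)
      (fun M ih hM => ?_) M
    by_contra hM'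
    obtain ⟨Z, p, _, hp, hZ⟩ := h M hM hM'
    exact hZ (ih Z p hp (j.prop_of_epi p hM))
  obtain ⟨B, hBj, hB, hmin⟩ := hex
  have hF : (lowerStar j).IsTorsionFree B := by
    intro Y hY f
    by_contra hf
    have hι : Abelian.image.ι f ≠ 0 := fun h => hf ((image_ι_eq_zero_iff f).1 h)
    exact hB (prop_of_mono_of_cokernel (lowerStar j).2.extensions (Abelian.image.ι f)
      ((lowerStar j).prop_image f hY) (hmin _ (cokernel.π _) (not_isIso_cokernel_π hι)))
  refine ⟨B, ⟨fun h => hB ((lowerStar j).prop_of_isZero h), fun f hf => ?_⟩, ?_⟩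
  · have hiso : IsIso (Abelian.factorThruImage f) := by
      by_contra h
      exact hf (eq_zero_of_isZero_image f
        ((hF.of_mono (Abelian.image.ι f)).isZero (hmin _ (Abelian.factorThruImage f) h)))
    have hmono : Mono f := by
      rw [← Abelian.image.fac f]
      infer_instance
    exact isIso_of_mono_endomorphism f
  · by_contra h
    have hle : torsionClosureObj B ≤ j := torsionClosureObj_le_iff.2 hBj
    exact hB ((le_sSup (lt_of_le_of_ne hle (Ne.symm h)) : torsionClosureObj B ≤ lowerStar j) B
      (mem_torsionClosureObj B))

/-- The torsion part of the class of all objects `X` such that every nonzero morphism from `X` to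
`B` has its kernel in `T`. -/
def torsionKernelClass (T : TorsionClass A) (B : A) (hB : T ≤ zeroOrEpiClass B) :
    TorsionClass A :=
  ⟨fun X => T.1 X ∧ ∀ f : X ⟶ B, f ≠ 0 → T.1 (kernel f),
    { containsZero := ⟨⟨_, isZero_zero A, T.prop_of_isZero (isZero_zero A),
        fun f hf => (hf ((isZero_zero A).eq_of_src _ _)).elim⟩⟩
      quotients := ⟨fun {X Y} p _ hX => ⟨T.prop_of_epi p hX.1, fun f hf => by
        have hk := hX.2 (p ≫ f) fun h => hf (by rw [← cancel_epi p, h, comp_zero])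
        have := epi_kernel_lift_comp p f
        exact T.prop_of_epi (kernel.lift f (kernel.ι (p ≫ f) ≫ p) _) hk⟩⟩
      extensions := ⟨fun {S} hS h₁ h₃ => by
        have := hS.mono_f
        have := hS.epi_g
        refine ⟨T.2.extensions.prop_X₂_of_shortExact hS h₁.1 h₃.1, fun f hf => ?_⟩
        obtain ⟨f₃, hf₃⟩ := exists_desc hS (f ≫ cokernel.π (S.f ≫ f))
          (by rw [← Category.assoc, cokernel.condition])
        refine prop_kernel_of_shortExact T.2.extensions hS f f₃ hf₃ ?_ ?_
        · by_cases h : S.f ≫ f = 0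
          · exact prop_kernel_of_factors T.2.quotients _ (𝟙 _) (by rw [h, comp_zero]) (kernel.ι _)
              (Category.comp_id _) h₁.1
          · exact h₁.2 _ h
        -- If `f` vanishes on `S.X₁`, then `f₃` is, up to an isomorphism of targets, the morphism
        -- induced by `f`. Otherwise `S.f ≫ f` is epi, the target of `f₃` is zero and its kernel is
        -- all of `S.X₃`.
        · by_cases h : S.f ≫ f = 0
          · obtain ⟨f', hf'⟩ := exists_desc hS f h
            have hf₃' : f₃ = f' ≫ cokernel.π (S.f ≫ f) := by
              rw [← cancel_epi S.g, hf₃, reassoc_of% hf']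
            have hπ : IsIso (cokernel.π (S.f ≫ f)) := by
              rw [h]
              infer_instance
            have hk := h₃.2 f' fun h' => hf (by rw [← hf', h', comp_zero])
            refine prop_kernel_of_factors T.2.quotients f₃ (kernel.ι f')
              (by rw [hf₃', kernel.condition_assoc, zero_comp])
              (kernel.lift f' (kernel.ι f₃) ?_) (kernel.lift_ι _ _ _) hk
            rw [← cancel_mono (cokernel.π (S.f ≫ f)), Category.assoc, ← hf₃', kernel.condition,
              zero_comp]
          · have : Epi (S.f ≫ f) := hB _ h₁.1 _ h
            exact prop_kernel_of_factors T.2.quotients _ (𝟙 _)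
              ((isZero_cokernel_of_epi (S.f ≫ f)).eq_of_tgt _ _) (kernel.ι _)
              (Category.comp_id _) h₃.1⟩ }⟩

/-- If `T` is the join of `T'` and the torsion class of a brick `B`, and no smaller torsion class
can replace the latter, then `B` belongs to the wide core of `T`. -/
theorem IsBrick.wideCore_of_sup_eq {B : A} (hB : IsBrick B) {T T' : TorsionClass A}
    (hT : torsionClosureObj B ⊔ T' = T) (hmin : ¬ (lowerStar (torsionClosureObj B) ⊔ T').1 B) :
    wideCore T B := by
  -- A nonzero image from `T'` would exhibit `B` as an extension of a proper quotient, in the lower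
  -- star, by an object of `T'`, against `hmin`.
  have hperp : T' ≤ leftPerp B := by
    intro Y hY f
    by_contra hf
    have hι : Abelian.image.ι f ≠ 0 := fun h => hf ((image_ι_eq_zero_iff f).1 h)
    refine hmin (prop_of_mono_of_cokernel (lowerStar (torsionClosureObj B) ⊔ T').2.extensions
      (Abelian.image.ι f) ((le_sup_right : T' ≤ lowerStar (torsionClosureObj B) ⊔ T') _
        (T'.prop_image f hY)) ((le_sup_left : _ ≤ lowerStar (torsionClosureObj B) ⊔ T') _ ?_))
    rw [hB.lowerStar_torsionClosureObj]
    exact mem_inf.2 ⟨TorsionClass.prop_of_epi _ (cokernel.π (Abelian.image.ι f))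
      (mem_torsionClosureObj B),
      hB.mem_leftPerp_of_epi (cokernel.π (Abelian.image.ι f)) (not_isIso_cokernel_π hι)⟩
  have hBT : T.1 B := hT ▸ (le_sup_left : _ ≤ torsionClosureObj B ⊔ T') B (mem_torsionClosureObj B)
  have hT'T : T' ≤ T := hT ▸ le_sup_right
  have hepi : T ≤ zeroOrEpiClass B := by
    rw [← hT]
    exact sup_le hB.torsionClosureObj_le_zeroOrEpiClass
      fun Y hY f hf => (hf (hperp Y hY f)).elim
  have hker : T ≤ torsionKernelClass T B hepi := by
    conv_lhs => rw [← hT]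
    refine sup_le (torsionClosureObj_le_iff.2 ⟨hBT, fun f hf => ?_⟩)
      fun Y hY => ⟨hT'T Y hY, fun f hf => (hf (hperp Y hY f)).elim⟩
    have := hB.isIso_of_ne_zero f hf
    exact T.prop_of_isZero (isZero_kernel_of_mono f)
  refine ⟨hBT, fun Y hY g => ?_⟩
  by_cases hg : g = 0
  · exact prop_kernel_of_factors T.2.quotients _ (𝟙 _) (by rw [hg, comp_zero]) (kernel.ι _)
      (Category.comp_id _) hY
  · exact (hker Y hY).2 g hg

theorem torsionClosure_wideCore_of_isCanonicalJoinRep [IsLengthCategory A] {T : TorsionClass A}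
    {s : Set (TorsionClass A)} (hs : IsCanonicalJoinRep T s) : torsionClosure (wideCore T) = T := by
  refine le_antisymm (torsionClosure_wideCore_le T) ?_
  conv_lhs => rw [hs.eq_sSup]
  refine sSup_le fun j hj => ?_
  obtain ⟨B, hB, rfl⟩ :=
    exists_isBrick_of_isCompletelyJoinIrreducible (hs.isCompletelyJoinIrreducible hj)
  refine torsionClosureObj_le_iff.2 (le_torsionClosure _ _
    (hB.wideCore_of_sup_eq (T' := sSup (s \ {torsionClosureObj B})) ?_ fun hmem => ?_))
  · rw [← sSup_insert, Set.insert_sdiff_singleton, Set.insert_eq_of_mem hj, ← hs.eq_sSup]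
  · have hlower : lowerStar (torsionClosureObj B) ≤ torsionClosureObj B :=
      sSup_le fun x hx => le_of_lt hx
    -- Were `B` in the smaller join, T(B) could be replaced by its lower star. Refinement would then
    -- place T(B) below its lower star or below another canonical joinand.
    have hT : T = sSup (insert (lowerStar (torsionClosureObj B)) (s \ {torsionClosureObj B})) := by
      rw [sSup_insert]
      refine le_antisymm ?_ (sup_le (hlower.trans ?_) (sSup_le fun x hx => ?_))
      · conv_lhs => rw [hs.eq_sSup]
        refine sSup_le fun x hx => ?_
        by_cases hxj : x = torsionClosureObj B
        · exact hxj ▸ torsionClosureObj_le_iff.2 hmem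
        · exact le_sup_of_le_right (le_sSup ⟨hx, hxj⟩)
      · exact (le_sSup hj).trans hs.eq_sSup.ge
      · exact (le_sSup hx.1).trans hs.eq_sSup.ge
    obtain ⟨b, rfl | hb, hle⟩ := hs.refines _ hT _ hj
    · rw [hB.lowerStar_torsionClosureObj] at hle
      exact hB.not_mem_leftPerp (mem_inf.1 (hle B (mem_torsionClosureObj B))).2
    · exact hb.2 (hs.antichain _ hj _ hb.1 hle).symm

/-! ### The kappa order -/

namespace IsWideSubcategory

variable [IsLengthCategory A]

/-- The torsion closure of a wide subcategory, as an element of the kappa order. -/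
def toKappaPoset (W : WideSubcategory A) : KappaPoset (TorsionClass A) :=
  ⟨torsionClosure W.1, _, W.2.isCanonicalJoinRep⟩

theorem mem_extKappa_toKappaPoset {W : WideSubcategory A} {X : A} :
    (toKappaPoset W).extKappa.1 X ↔ ∀ M, W.1 M → ∀ f : X ⟶ M, f = 0 := by
  rw [KappaPoset.extKappa,
    (toKappaPoset W).isCanonicalJoinRep_CJR.unique W.2.isCanonicalJoinRep, W.2.mem_sInf_kappa_iff]

/-- For the forward direction, an object of `W` is in T(W') and receives nothing from ⊥W', which is
contained in ⊥W; so it belongs to `W'`. -/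
theorem toKappaPoset_le_iff {W W' : WideSubcategory A} :
    toKappaPoset W ≤ toKappaPoset W' ↔ W ≤ W' := by
  constructor
  · rintro ⟨h, h'⟩ X hX
    refine W'.2.prop_of_torsionClosure (h X (le_torsionClosure _ X hX)) fun Y i hY => ?_
    exact mem_extKappa_toKappaPoset.1 (h' Y (mem_extKappa_toKappaPoset.2 hY)) X hX i
  · intro h
    refine ⟨torsionClosure_le_iff.2 fun X hX => le_torsionClosure _ X (h X hX), fun X hX => ?_⟩
    rw [mem_extKappa_toKappaPoset] at hX ⊢
    exact fun M hM => hX M (h M hM)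

theorem toKappaPoset_surjective : Function.Surjective (toKappaPoset (A := A)) := by
  intro x
  obtain ⟨s, hs⟩ := x.hasCJR
  exact ⟨⟨wideCore x.val, isWideSubcategory_wideCore _⟩,
    KappaPoset.ext (torsionClosure_wideCore_of_isCanonicalJoinRep hs)⟩

/-- The order isomorphism from wide subcategories to the kappa order on torsion classes. -/
def orderIsoKappaPoset : WideSubcategory A ≃o KappaPoset (TorsionClass A) :=
  RelIso.ofSurjective (OrderEmbedding.ofMapLEIff toKappaPoset fun _ _ => toKappaPoset_le_iff)
    toKappaPoset_surjective

end IsWideSubcategory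

end KappaOrder
end

theorem theorem4 {A : Type u} [Category.{v} A] [Abelian A] [KappaOrder.IsLengthCategory A] :
    KappaOrder.IsCompletelySemidistributive (KappaOrder.TorsionClass A) ∧
    ∃ e : KappaOrder.WideSubcategory A ≃o KappaOrder.KappaPoset (KappaOrder.TorsionClass A),
      ∀ W : KappaOrder.WideSubcategory A, (e W).val = KappaOrder.torsionClosure W.1 :=
  ⟨KappaOrder.TorsionClass.isCompletelySemidistributive A,
    KappaOrder.IsWideSubcategory.orderIsoKappaPoset, fun _ => rfl⟩
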